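/- Let $\mathcal R=\langle \mathbb R,<,+,\dots\rangle$ be an o-minimal expansion of the ordered group of the reals, let $P\subseteq\mathbb R$, and let $\langle\mathcal R,P\rangle$ be the expansion of $\mathcal R$ by a unary predicate for $P$. "$\mathcal R$-definable" means definable with parameters in $\mathcal R$, and "definable" means definable with parameters in $\langle\mathcal R,P\rangle$. Put $\mathrm{conv}(P)=\bigcup_{x<y,\;x,y\in P}[x,y]$. Assume that $P$ is discrete, is closed in $\mathrm{conv}(P)$, has no maximal element, and that $0<x$ for all $x\in P$. Let $$\lambda:\mathbb R\to P\cup\{0\},\qquad \lambda(x)=\begin{cases}\max\bigl(P\cap(-\infty,x]\bigr)&\text{if }x\in\mathrm{conv}(P),\\ 0&\text{otherwise,}\end{cases}$$ let $s:P\to P$, $s(x)=\min\{y\in P: x<y\}$, be the successor function, and let $s^{-1}:s(P)\to P$ be its inverse. The basic functions are $\lambda$, $s$, $s^{-1}$ and all $\mathcal R$-definable (possibly partial) functions $\mathbb R^k\rightharpoonup\mathbb R$, $k\ge 0$. A compositional iterate of basic functions is a (possibly partial) function $\mathbb R^l\rightharpoonup\mathbb R$ obtained from basic functions by finitely many compositions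 $x\mapsto h(h_1(x),\dots,h_k(x))$, each taken on its natural domain. Assume that, for every $l$, every definable set $X\subseteq\mathbb R^l$ is a finite union of sets $Y$, each satisfying the following property. $(A)$ There are finitely many compositional iterates of basic functions $f_1,\dots,f_n$ and $g_1,\dots,g_m$ in $l$ variables such that $$Y=\{x\in\mathbb R^l : \text{for all } i,j,\ f_i(x)=0 \text{ and } g_j(x)>0\},$$ where an equation or inequality is taken to hold at $x$ only if the function in it is defined at $x$ (in particular, the $f_i$ and $g_j$ may be total). Then $\langle\mathcal R,P\rangle$ has (DP)(I): for every $n$ and every definable set $X\subseteq\mathbb R^n$ there are an $m$, an $\mathcal R$-definable family $\{Y_t\}_{t\in\mathbb R^m}$ of subsets of $\mathbb R^n$, and a definable set $S\subseteq\mathbb R^m$ with $\dim S=0$, such that $X=\bigcup_{t\in S}Y_t$. Here $\dim S$ is the maximal $k$ such that the projection of $S$ to some $k$ of the coordinates has non-empty interior. -/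

import Mathlib

open FirstOrder Set Topology

universe u v

noncomputable section

namespace OMinExp

/-! ### The structures `𝓡` and `⟨𝓡, P⟩`, and definability in them -/

/-- The relation symbols of the language with a single unary predicate symbol. -/
inductive PredRel : ℕ → Type
  | pred : PredRel 1

/-- The language with a single unary predicate symbol. -/
def predLang : FirstOrder.Language := ⟨fun _ => Empty, PredRel⟩

/-- The real line as a structure in which the unary predicate is interpreted as `P`. -/
abbrev predStructure (P : Set ℝ) : predLang.Structure ℝ where
  funMap := fun f _ => Empty.elim f
  RelMap := fun {_} r => match r with
    | PredRel.pred => fun v => v 0 ∈ P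

section Structures

variable (L : FirstOrder.Language.{u, v}) [L.Structure ℝ]

/-- Definable, with parameters, in the `L`-structure `𝓡` on the real line. -/
def RDefinable {α : Type} (X : Set (α → ℝ)) : Prop :=
  (univ : Set ℝ).Definable L X

/-- Definable, with parameters, in the expansion `⟨𝓡, P⟩` of the `L`-structure `𝓡` by a unary
predicate for `P`. -/
def ExpDefinable (P : Set ℝ) {α : Type} (X : Set (α → ℝ)) : Prop :=
  letI : predLang.Structure ℝ := predStructure P
  (univ : Set ℝ).Definable (L.sum predLang) X

/-- `𝓡 = ⟨ℝ, <, +, …⟩`: the order and the addition of the reals belong to the structure (up to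
interdefinability with parameters). -/
def ExpandsOrderedGroup : Prop :=
  RDefinable L {x : Fin 2 → ℝ | x 0 < x 1} ∧
    RDefinable L {x : Fin 3 → ℝ | x 0 + x 1 = x 2}

/-- o-minimality: every definable (with parameters) subset of the line is a finite union of points
and open intervals with endpoints in `ℝ ∪ {±∞}`. -/
def OMinimal : Prop :=
  ∀ X : Set ℝ, (univ : Set ℝ).Definable₁ L X →
    ∃ T : Set (Set ℝ), T.Finite ∧ X = ⋃₀ T ∧
      ∀ I ∈ T, (∃ a : ℝ, I = {a}) ∨
        ∃ a b : EReal, I = {x : ℝ | a < (x : EReal) ∧ (x : EReal) < b}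

/-- A partial function `ℝᵏ ⇀ ℝ` is `𝓡`-definable if its graph is. -/
def RDefinableFun {k : ℕ} (F : (Fin k → ℝ) →. ℝ) : Prop :=
  RDefinable L {w : Fin k ⊕ Fin 1 → ℝ | w (Sum.inr 0) ∈ F (fun i => w (Sum.inl i))}

end Structures

/-! ### The set `P` and the functions `λ`, `s`, `s⁻¹` -/

/-- The convex hull `⋃_{x < y ∈ X} [x, y]`. -/
def conv (X : Set ℝ) : Set ℝ := {z | ∃ x ∈ X, ∃ y ∈ X, x < y ∧ z ∈ Icc x y}

/-- `P` is discrete, closed in its convex hull, without a maximum, and `0 < P`. -/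
structure Admissible (P : Set ℝ) : Prop where
  discrete : IsDiscrete P
  closed : IsClosed ((↑) ⁻¹' P : Set (conv P))
  no_max : ∀ x ∈ P, ∃ y ∈ P, x < y
  pos : ∀ x ∈ P, 0 < x

open Classical in
/-- `λ(x) = max (P ∩ (-∞, x])` if `x ∈ conv P`, and `λ(x) = 0` otherwise. (The supremum is attained
for admissible `P`, see `Admissible.isGreatest_lam`.) -/
def lam (P : Set ℝ) (x : ℝ) : ℝ := if x ∈ conv P then sSup (P ∩ Iic x) else 0

/-- `min {y ∈ P : x < y}`. (The infimum is attained for admissible `P` and `x ∈ P`, see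
`Admissible.isLeast_next`.) -/
def next (P : Set ℝ) (x : ℝ) : ℝ := sInf {y | y ∈ P ∧ x < y}

/-- The successor function `s : P → P`, as a partial function on the line with domain `P`. -/
def succ (P : Set ℝ) : ℝ →. ℝ := fun x => ⟨x ∈ P, fun _ => next P x⟩

/-- The inverse `s⁻¹` of the successor function, as a partial function on the line with domain
`s(P)`. (`s` is injective for admissible `P`, see `Admissible.injOn_next`.) -/
def pred (P : Set ℝ) : ℝ →. ℝ := fun y => ⟨∃ x ∈ P, next P x = y, fun h => h.choose⟩

namespace Admissible

variable {P : Set ℝ}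

theorem mem_of_mem_closure (hP : Admissible P) {z : ℝ} (hz : z ∈ conv P)
    (hc : z ∈ closure P) : z ∈ P := by
  obtain ⟨C, hC, hCP⟩ := isClosed_induced_iff.1 hP.closed
  have key : ∀ w (hw : w ∈ conv P), w ∈ C ↔ w ∈ P := fun w hw => by
    have := Set.ext_iff.1 hCP ⟨w, hw⟩
    simpa using this
  have hsub : P ⊆ C := fun w hw => by
    obtain ⟨y, hy, hwy⟩ := hP.no_max w hw
    exact (key w ⟨w, hw, y, hy, hwy, le_refl _, hwy.le⟩).2 hw
  exact (key z hz).1 (closure_minimal hsub hC hc)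

theorem isGreatest_lam (hP : Admissible P) {x : ℝ} (hx : x ∈ conv P) :
    IsGreatest (P ∩ Iic x) (lam P x) := by
  obtain ⟨p, hp, q, hq, hpq, hpx, hxq⟩ := hx
  have hne : (P ∩ Iic x).Nonempty := ⟨p, hp, hpx⟩
  have hbdd : BddAbove (P ∩ Iic x) := ⟨x, fun y hy => hy.2⟩
  have hl : lam P x = sSup (P ∩ Iic x) := if_pos ⟨p, hp, q, hq, hpq, hpx, hxq⟩
  rw [hl]
  have hle : sSup (P ∩ Iic x) ≤ x := csSup_le hne fun y hy => hy.2
  refine ⟨⟨hP.mem_of_mem_closure ?_ ?_, hle⟩, fun y hy => le_csSup hbdd hy⟩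
  · exact ⟨p, hp, q, hq, hpq, le_csSup hbdd ⟨hp, hpx⟩, hle.trans hxq⟩
  · exact closure_mono inter_subset_left (csSup_mem_closure hne hbdd)

theorem isLeast_next (hP : Admissible P) {x : ℝ} (hx : x ∈ P) :
    IsLeast {y | y ∈ P ∧ x < y} (next P x) := by
  obtain ⟨q, hq, hxq⟩ := hP.no_max x hx
  have hne : {y | y ∈ P ∧ x < y}.Nonempty := ⟨q, hq, hxq⟩
  have hbdd : BddBelow {y | y ∈ P ∧ x < y} := ⟨x, fun y hy => hy.2.le⟩
  obtain ⟨U, hU, hUP⟩ := isDiscrete_iff_forall_mem_exists_isOpen.1 hP.discrete x hx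
  have hxU : x ∈ U := (hUP.ge (mem_singleton x)).1
  obtain ⟨ε, hε, hball⟩ := Metric.isOpen_iff.1 hU x hxU
  have hlt : x < next P x := by
    refine lt_of_lt_of_le (lt_add_of_pos_right x hε) (le_csInf hne fun y hy => ?_)
    by_contra! h
    have hyU : y ∈ U := hball (by
      rw [Metric.mem_ball, Real.dist_eq, abs_lt]
      constructor <;> linarith [hy.2])
    have : y = x := hUP.le ⟨hyU, hy.1⟩
    exact absurd hy.2 (by rw [this]; exact lt_irrefl x)
  refine ⟨⟨hP.mem_of_mem_closure ?_ ?_, hlt⟩, fun y hy => csInf_le hbdd hy⟩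
  · exact ⟨x, hx, q, hq, hxq, hlt.le, csInf_le hbdd ⟨hq, hxq⟩⟩
  · exact closure_mono (fun y hy => hy.1) (csInf_mem_closure hne hbdd)

theorem injOn_next (hP : Admissible P) : InjOn (next P) P := by
  intro x hx y hy hxy
  have h1 := hP.isLeast_next hx
  have h2 := hP.isLeast_next hy
  rcases lt_trichotomy x y with h | h | h
  · exact absurd (h1.2 ⟨hy, h⟩) (not_le.2 (hxy ▸ h2.1.2))
  · exact h
  · exact absurd (h2.2 ⟨hx, h⟩) (not_le.2 (hxy ▸ h1.1.2))

end Admissible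

/-! ### Basic functions and their compositional iterates -/

section Basic

variable (L : FirstOrder.Language.{u, v}) [L.Structure ℝ] (P : Set ℝ)

/-- The basic functions: `λ`, `s`, `s⁻¹` (as partial functions of one variable) and all
`𝓡`-definable (partial) functions in any number of variables. -/
inductive IsBasic : ∀ {k : ℕ}, ((Fin k → ℝ) →. ℝ) → Prop
  | definable {k : ℕ} (F : (Fin k → ℝ) →. ℝ) (hF : RDefinableFun L F) : IsBasic F
  | lam : IsBasic (fun v : Fin 1 → ℝ => Part.some (lam P (v 0)))
  | succ : IsBasic (fun v : Fin 1 → ℝ => succ P (v 0))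
  | pred : IsBasic (fun v : Fin 1 → ℝ => pred P (v 0))

/-- The composition `x ↦ F (h₁ x, …, hₖ x)` of partial functions, on its natural domain. -/
def compTuple {k l : ℕ} (F : (Fin k → ℝ) →. ℝ) (h : Fin k → ((Fin l → ℝ) →. ℝ)) :
    (Fin l → ℝ) →. ℝ :=
  fun x => Part.bind ⟨∀ i, (h i x).Dom, fun d i => (h i x).get (d i)⟩ F

/-- The (partial) functions `ℝˡ ⇀ ℝ` that are compositional iterates of basic functions. -/
inductive IsIterate {l : ℕ} : ((Fin l → ℝ) →. ℝ) → Prop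
  | basic (F : (Fin l → ℝ) →. ℝ) (hF : IsBasic L P F) : IsIterate F
  | comp {k : ℕ} (F : (Fin k → ℝ) →. ℝ) (hF : IsBasic L P F)
      (h : Fin k → ((Fin l → ℝ) →. ℝ)) (hh : ∀ i, IsIterate (h i)) : IsIterate (compTuple F h)

/-- Property (A): `Y = {x : f₁ x = ⋯ = fₙ x = 0, g₁ x > 0, …, gₘ x > 0}` where all `fᵢ` and `gⱼ` are
compositional iterates of basic functions. (An equation or inequality holds at `x` only if the
function in it is defined at `x`; in particular the `fᵢ`, `gⱼ` may be total functions.) -/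
def PropertyA {l : ℕ} (Y : Set (Fin l → ℝ)) : Prop :=
  ∃ (n m : ℕ) (f : Fin n → ((Fin l → ℝ) →. ℝ)) (g : Fin m → ((Fin l → ℝ) →. ℝ)),
    (∀ i, IsIterate L P (f i)) ∧ (∀ j, IsIterate L P (g j)) ∧
      Y = {x | (∀ i, (0 : ℝ) ∈ f i x) ∧ ∀ j, ∃ z ∈ g j x, 0 < z}

/-! ### Dimension and the first decomposition property -/

/-- The dimension of `X ⊆ ℝⁿ`: the maximal `k` such that the projection of `X` to some `k` of the
coordinates has non-empty interior (`⊥` for the empty set). -/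
def coordDim {n : ℕ} (X : Set (Fin n → ℝ)) : WithBot ℕ∞ :=
  ⨆ (I : Finset (Fin n)) (_ : (interior ((fun (x : Fin n → ℝ) (i : I) => x i) '' X)).Nonempty),
    ((I.card : ℕ∞) : WithBot ℕ∞)

/-- (DP)(I) for `⟨𝓡, P⟩`: every definable `X ⊆ ℝⁿ` is the union of the members `Y_t`, `t ∈ S`, of an
`𝓡`-definable family `{Y_t}_{t ∈ ℝᵐ}` of subsets of `ℝⁿ`, where `S ⊆ ℝᵐ` is definable of
dimension `0`. -/
def HasDPI : Prop :=
  ∀ (n : ℕ) (X : Set (Fin n → ℝ)), ExpDefinable L P X →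
    ∃ (m : ℕ) (Y : (Fin m → ℝ) → Set (Fin n → ℝ)) (S : Set (Fin m → ℝ)),
      RDefinable L {w : Fin n ⊕ Fin m → ℝ |
        (fun i => w (Sum.inl i)) ∈ Y (fun j => w (Sum.inr j))} ∧
      ExpDefinable L P S ∧ coordDim S = 0 ∧ X = ⋃ t ∈ S, Y t

end Basic

end OMinExp

end

/-! Call a set sparse if it is the union of an `𝓡`-definable family indexed by a definable set of
tuples from `P` (`IsSparseUnion`). A discrete `P` is countable, so a nonempty index set of this kind
has dimension `0` (`coordDim_eq_zero`), and it suffices to show that sets with property (A) are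
sparse. Sparse sets are closed under finite intersections and unions, projections and substitution
of coordinates. Complements are not needed: membership in a set with property (A) is expressed from
graphs of basic functions by conjunction and existential quantification over intermediate values.
What remains is that graphs of basic functions are sparse. The graph of `s` is a definable subset of
`P × P`, so it can serve as its own index set; that of `s⁻¹` is its transpose. On `conv P`, which is
an interval and hence `𝓡`-definable, `λ(x) = z` means `z ∈ P` and `z ≤ x < s(z)`, which reduces `λ`
to `s`. -/

namespace OMinExp

open FirstOrder.Language

/-! ### Definability of order conditions and intervals -/

section Definability

variable {L : FirstOrder.Language.{u, v}} [L.Structure ℝ] {α β : Type}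

theorem RDefinable.expDefinable {X : Set (α → ℝ)} (h : RDefinable L X) (P : Set ℝ) :
    ExpDefinable L P X := by
  let _ : predLang.Structure ℝ := predStructure P
  exact Definable.map_expansion h LHom.sumInl

theorem expDefinable_univ (P : Set ℝ) : ExpDefinable L P (univ : Set (α → ℝ)) :=
  RDefinable.expDefinable definable_univ P

theorem expDefinable_mem (P : Set ℝ) (i : α) : ExpDefinable L P {v : α → ℝ | v i ∈ P} := by
  let _ : predLang.Structure ℝ := predStructure P
  have h : (univ : Set ℝ).Definable predLang {v : α → ℝ | v i ∈ P} := by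
    refine ⟨(predLang.lhomWithConstants univ).onFormula
      (Relations.formula₁ (PredRel.pred : predLang.Relations 1) (Term.var i)), ?_⟩
    ext v
    simp only [LHom.realize_onFormula, mem_ofPred_eq]
    rfl
  exact h.map_expansion LHom.sumInr

theorem rDefinable_eq (i j : α) : RDefinable L {v : α → ℝ | v i = v j} :=
  ⟨(Term.var i).equal (Term.var j), by ext; simp⟩

theorem rDefinable_eq_const (i : α) (c : ℝ) : RDefinable L {v : α → ℝ | v i = c} :=
  (Definable.singleton_of_mem L (mem_univ c)).preimage_comp fun _ : Fin 1 => i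

theorem ExpandsOrderedGroup.rDefinable_lt (hL : ExpandsOrderedGroup L) (i j : α) :
    RDefinable L {v : α → ℝ | v i < v j} :=
  Definable.preimage_comp ![i, j] hL.1

theorem ExpandsOrderedGroup.rDefinable_lt_const (hL : ExpandsOrderedGroup L) (i : α) (c : ℝ) :
    RDefinable L {v : α → ℝ | v i < c} := by
  have h := Definable.exists_of_finite (β := Fin 1) <|
    Definable.inter (hL.rDefinable_lt (Sum.inl i) (Sum.inr (0 : Fin 1)))
      (rDefinable_eq_const (L := L) (Sum.inr (0 : Fin 1)) c)
  refine (congrArg _ ?_).mp h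
  ext v
  exact ⟨fun ⟨u, h1, h2⟩ => lt_of_lt_of_eq h1 h2, fun h => ⟨fun _ => c, h, rfl⟩⟩

theorem ExpandsOrderedGroup.rDefinable_const_lt (hL : ExpandsOrderedGroup L) (i : α) (c : ℝ) :
    RDefinable L {v : α → ℝ | c < v i} := by
  have h := ((hL.rDefinable_lt_const i c).union (rDefinable_eq_const i c)).compl
  refine (congrArg _ ?_).mp h
  ext v
  rw [mem_compl_iff, mem_union, mem_ofPred_eq, mem_ofPred_eq, ← le_iff_lt_or_eq, not_le,
    mem_ofPred_eq]

/-- By completeness of `ℝ`, a convex set is an interval whose endpoints are real or infinite, and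
the real ones may be used as parameters. This serves for `conv P`. -/
theorem ExpandsOrderedGroup.rDefinable_mem_ordConnected (hL : ExpandsOrderedGroup L) (i : α)
    {I : Set ℝ} (hI : I.OrdConnected) : RDefinable L {v : α → ℝ | v i ∈ I} := by
  have hlt : ∀ c, RDefinable L {v : α → ℝ | v i ∈ Iio c} := hL.rDefinable_lt_const i
  have hgt : ∀ c, RDefinable L {v : α → ℝ | v i ∈ Ioi c} := hL.rDefinable_const_lt i
  have hle : ∀ c, RDefinable L {v : α → ℝ | v i ∈ Iic c} := fun c => by
    refine (congrArg _ ?_).mp (hgt c).compl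
    ext v; simp
  have hge : ∀ c, RDefinable L {v : α → ℝ | v i ∈ Ici c} := fun c => by
    refine (congrArg _ ?_).mp (hlt c).compl
    ext v; simp
  rcases hI.isPreconnected.mem_intervals with h | h | h | h | h | h | h | h | h | h <;> rw [h]
  · exact (hge _).inter (hle _)
  · exact (hge _).inter (hlt _)
  · exact (hgt _).inter (hle _)
  · exact (hgt _).inter (hlt _)
  · exact hge _
  · exact hgt _
  · exact hle _
  · exact hlt _
  · exact definable_univ
  · exact definable_empty

theorem ordConnected_conv (P : Set ℝ) : (conv P).OrdConnected := by
  refine ⟨fun z ⟨x, hx, y, hy, hxy, hz⟩ z' ⟨x', hx', y', hy', hxy', hz'⟩ w hw => ?_⟩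
  have hxw : x ≤ w := hz.1.trans hw.1
  have hwy' : w ≤ y' := hw.2.trans hz'.2
  rcases le_or_gt w y with h | h
  · exact ⟨x, hx, y, hy, hxy, hxw, h⟩
  · exact ⟨x, hx, y', hy', hxy.trans (h.trans_le hwy'), hxw, hwy'⟩

end Definability

/-! ### Sparse unions and their closure properties -/

section Sparse

variable (L : FirstOrder.Language.{u, v}) [L.Structure ℝ] (P : Set ℝ)

/-- `X` is the union of an `𝓡`-definable family over a definable set of tuples from `P`. -/
def IsSparseUnion {α : Type} (X : Set (α → ℝ)) : Prop :=
  ∃ (m : ℕ) (Z : Set (α ⊕ Fin m → ℝ)) (S : Set (Fin m → ℝ)),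
    RDefinable L Z ∧ ExpDefinable L P S ∧ (∀ t ∈ S, ∀ j, t j ∈ P) ∧
      X = {x | ∃ t ∈ S, Sum.elim x t ∈ Z}

end Sparse

section SparseLemmas

variable {L : FirstOrder.Language.{u, v}} [L.Structure ℝ] {P : Set ℝ} {α β : Type}

theorem RDefinable.isSparseUnion {X : Set (α → ℝ)} (h : RDefinable L X) : IsSparseUnion L P X :=
  ⟨0, _, univ, h.preimage_comp Sum.inl, expDefinable_univ P, fun _ _ j => j.elim0, by
    ext x
    exact ⟨fun hx => ⟨Fin.elim0, trivial, hx⟩, fun ⟨_, _, hx⟩ => hx⟩⟩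

/-- A definable set of tuples from `P` is a sparse union of singletons. -/
theorem ExpDefinable.isSparseUnion {m : ℕ} {S : Set (Fin m → ℝ)} (h : ExpDefinable L P S)
    (hS : ∀ t ∈ S, ∀ j, t j ∈ P) : IsSparseUnion L P S :=
  ⟨m, _, S, definable_iInter_of_finite fun j : Fin m => rDefinable_eq (Sum.inl j) (Sum.inr j), h,
    hS, by
      ext x
      simp only [mem_ofPred_eq, mem_iInter, Sum.elim_inl, Sum.elim_inr]
      exact ⟨fun hx => ⟨x, hx, fun _ => rfl⟩, fun ⟨t, ht, e⟩ => (funext e : x = t) ▸ ht⟩⟩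

namespace IsSparseUnion

theorem empty : IsSparseUnion L P (∅ : Set (α → ℝ)) :=
  RDefinable.isSparseUnion definable_empty

theorem preimage_comp {X : Set (α → ℝ)} (h : IsSparseUnion L P X) (f : α → β) :
    IsSparseUnion L P {v : β → ℝ | v ∘ f ∈ X} := by
  obtain ⟨m, Z, S, hZ, hS, hP, rfl⟩ := h
  refine ⟨m, _, S, hZ.preimage_comp (Sum.map f id), hS, hP, ?_⟩
  ext v
  refine exists_congr fun t => and_congr_right fun _ => ?_
  rw [mem_preimage, Sum.elim_comp_map, Function.comp_id]

/-- The two existential quantifiers commute, so the projection is applied to each member of the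
family and the index set stays the same. -/
theorem exists_of_finite [Finite β] {X : Set (α ⊕ β → ℝ)} (h : IsSparseUnion L P X) :
    IsSparseUnion L P {v : α → ℝ | ∃ w : β → ℝ, Sum.elim v w ∈ X} := by
  obtain ⟨m, Z, S, hZ, hS, hP, rfl⟩ := h
  have hZ' : RDefinable L _ := Definable.exists_of_finite (β := β) <|
    hZ.preimage_comp (Sum.elim (Sum.elim (Sum.inl ∘ Sum.inl) Sum.inr) (Sum.inl ∘ Sum.inr) :
      (α ⊕ β) ⊕ Fin m → (α ⊕ Fin m) ⊕ β)
  refine ⟨m, _, S, hZ', hS, hP, ?_⟩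
  ext v
  have key : ∀ (w : β → ℝ) (t : Fin m → ℝ),
      Sum.elim (Sum.elim v t) w ∘ (Sum.elim (Sum.elim (Sum.inl ∘ Sum.inl) Sum.inr)
        (Sum.inl ∘ Sum.inr) : (α ⊕ β) ⊕ Fin m → (α ⊕ Fin m) ⊕ β) =
      Sum.elim (Sum.elim v w) t := fun w t => by
    ext ((_ | _) | _) <;> rfl
  simp only [mem_ofPred_eq, mem_preimage, key]
  exact ⟨fun ⟨w, t, ht, h⟩ => ⟨t, ht, w, h⟩, fun ⟨t, ht, w, h⟩ => ⟨w, t, ht, h⟩⟩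

theorem exists_append_iff {m n : ℕ} {Q : (Fin m → ℝ) → (Fin n → ℝ) → Prop} :
    (∃ t : Fin (m + n) → ℝ, Q (t ∘ Fin.castAdd n) (t ∘ Fin.natAdd m)) ↔ ∃ a b, Q a b := by
  refine ⟨fun ⟨t, h⟩ => ⟨_, _, h⟩, fun ⟨a, b, h⟩ => ⟨Fin.append a b, ?_⟩⟩
  have h1 : Fin.append a b ∘ Fin.castAdd n = a := funext fun i => Fin.append_left a b i
  have h2 : Fin.append a b ∘ Fin.natAdd m = b := funext fun i => Fin.append_right a b i
  rwa [h1, h2]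

/-- The product of two definable sets of tuples from `P` is again such a set. -/
theorem prod_parameters {m n : ℕ} {S : Set (Fin m → ℝ)} {T : Set (Fin n → ℝ)}
    (hS : ExpDefinable L P S) (hT : ExpDefinable L P T) (hSP : ∀ t ∈ S, ∀ j, t j ∈ P)
    (hTP : ∀ t ∈ T, ∀ j, t j ∈ P) :
    ExpDefinable L P {t : Fin (m + n) → ℝ | t ∘ Fin.castAdd n ∈ S ∧ t ∘ Fin.natAdd m ∈ T} ∧
      ∀ t ∈ {t : Fin (m + n) → ℝ | t ∘ Fin.castAdd n ∈ S ∧ t ∘ Fin.natAdd m ∈ T},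
        ∀ j, t j ∈ P := by
  let _ : predLang.Structure ℝ := predStructure P
  refine ⟨Definable.inter (hS.preimage_comp (Fin.castAdd n)) (hT.preimage_comp (Fin.natAdd m)),
    fun t ht j => ?_⟩
  exact Fin.addCases (motive := fun j => t j ∈ P) (fun i => hSP _ ht.1 i) (fun i => hTP _ ht.2 i) j

/-- Index by pairs of parameters and intersect the corresponding members. -/
theorem inter {X Y : Set (α → ℝ)} (hX : IsSparseUnion L P X) (hY : IsSparseUnion L P Y) :
    IsSparseUnion L P (X ∩ Y) := by
  obtain ⟨m, Z, S, hZ, hS, hSP, rfl⟩ := hX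
  obtain ⟨n, W, T, hW, hT, hTP, rfl⟩ := hY
  obtain ⟨h1, h2⟩ := prod_parameters hS hT hSP hTP
  refine ⟨m + n, _, _, (hZ.preimage_comp (Sum.map id (Fin.castAdd n))).inter
    (hW.preimage_comp (Sum.map id (Fin.natAdd m))), h1, h2, ?_⟩
  ext x
  simp only [mem_inter_iff, mem_ofPred_eq, mem_preimage, Sum.elim_comp_map, Function.comp_id]
  rw [exists_append_iff (Q := fun a b => (a ∈ S ∧ b ∈ T) ∧ Sum.elim x a ∈ Z ∧ Sum.elim x b ∈ W)]
  exact ⟨fun ⟨⟨a, ha, h⟩, b, hb, h'⟩ => ⟨a, b, ⟨ha, hb⟩, h, h'⟩,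
    fun ⟨a, b, ⟨ha, hb⟩, h, h'⟩ => ⟨⟨a, ha, h⟩, b, hb, h'⟩⟩

theorem union {X Y : Set (α → ℝ)} (hX : IsSparseUnion L P X) (hY : IsSparseUnion L P Y) :
    IsSparseUnion L P (X ∪ Y) := by
  -- The union is indexed by `S × T`, which loses one set if the other has no parameters; hence the
  -- empty cases are split off.
  rcases X.eq_empty_or_nonempty with h0 | h0
  · rwa [h0, empty_union]
  rcases Y.eq_empty_or_nonempty with h0' | h0'
  · rwa [h0', union_empty]
  obtain ⟨m, Z, S, hZ, hS, hSP, rfl⟩ := hX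
  obtain ⟨n, W, T, hW, hT, hTP, rfl⟩ := hY
  obtain ⟨-, a₀, ha₀, -⟩ := h0
  obtain ⟨-, b₀, hb₀, -⟩ := h0'
  obtain ⟨h1, h2⟩ := prod_parameters hS hT hSP hTP
  refine ⟨m + n, _, _, (hZ.preimage_comp (Sum.map id (Fin.castAdd n))).union
    (hW.preimage_comp (Sum.map id (Fin.natAdd m))), h1, h2, ?_⟩
  ext x
  simp only [mem_union, mem_ofPred_eq, mem_preimage, Sum.elim_comp_map, Function.comp_id]
  rw [exists_append_iff (Q := fun a b => (a ∈ S ∧ b ∈ T) ∧ (Sum.elim x a ∈ Z ∨ Sum.elim x b ∈ W))]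
  constructor
  · rintro (⟨a, ha, h⟩ | ⟨b, hb, h⟩)
    · exact ⟨a, b₀, ⟨ha, hb₀⟩, Or.inl h⟩
    · exact ⟨a₀, b, ⟨ha₀, hb⟩, Or.inr h⟩
  · rintro ⟨a, b, ⟨ha, hb⟩, h | h⟩
    · exact Or.inl ⟨a, ha, h⟩
    · exact Or.inr ⟨b, hb, h⟩

theorem iInter {n : ℕ} {X : Fin n → Set (α → ℝ)} (h : ∀ i, IsSparseUnion L P (X i)) :
    IsSparseUnion L P (⋂ i, X i) := by
  induction n with
  | zero =>
    rw [iInter_of_empty]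
    exact RDefinable.isSparseUnion definable_univ
  | succ n ih =>
    have e : ⋂ i, X i = X 0 ∩ ⋂ i : Fin n, X i.succ := by
      ext x
      simp only [mem_iInter, mem_inter_iff, Fin.forall_fin_succ]
    rw [e]
    exact (h 0).inter (ih fun i => h i.succ)

theorem sUnion {T : Set (Set (α → ℝ))} (hT : T.Finite) (h : ∀ X ∈ T, IsSparseUnion L P X) :
    IsSparseUnion L P (⋃₀ T) := by
  induction T, hT using Set.Finite.induction_on with
  | empty =>
    rw [sUnion_empty]
    exact empty
  | insert _ _ ih =>
    rw [sUnion_insert]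
    exact (h _ (mem_insert _ _)).union (ih fun X hX => h X (mem_insert_of_mem _ hX))

end IsSparseUnion

/-! ### The graphs of `s` and `λ` -/

/-- The graph of the successor function is definable. -/
theorem expDefinable_next (hL : ExpandsOrderedGroup L) (hP : Admissible P) :
    ExpDefinable L P {v : Fin 2 → ℝ | v 0 ∈ P ∧ next P (v 0) = v 1} := by
  let _ : predLang.Structure ℝ := predStructure P
  have hlt : ∀ {γ : Type} (i j : γ),
      (univ : Set ℝ).Definable (L.sum predLang) {v : γ → ℝ | v i < v j} :=
    fun i j => (hL.rDefinable_lt i j).expDefinable P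
  have hmem : ∀ {γ : Type} (i : γ),
      (univ : Set ℝ).Definable (L.sum predLang) {v : γ → ℝ | v i ∈ P} :=
    fun i => expDefinable_mem P i
  -- Some point of `P` lies strictly between the two coordinates. Negating this is harmless, since
  -- only definability in `⟨𝓡, P⟩` is claimed.
  have hex := Definable.exists_of_finite (β := Fin 1) <|
    (hmem (Sum.inr (0 : Fin 1))).inter <|
      (hlt (Sum.inl (0 : Fin 2)) (Sum.inr 0)).inter (hlt (Sum.inr 0) (Sum.inl 1))
  refine (congrArg _ ?_).mp
    ((hmem (0 : Fin 2)).inter ((hmem 1).inter ((hlt 0 1).inter hex.compl)))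
  ext v
  constructor
  · rintro ⟨h0, h1, h01, hn⟩
    refine ⟨h0, (hP.isLeast_next h0).unique ⟨⟨h1, h01⟩, fun y hy => ?_⟩⟩
    by_contra! hlt
    exact hn ⟨fun _ => y, hy.1, hy.2, hlt⟩
  · rintro ⟨h0, h⟩
    have hl := hP.isLeast_next h0
    rw [h] at hl
    exact ⟨h0, hl.1.1, hl.1.2, fun ⟨u, h1, h2, h3⟩ => absurd (hl.2 ⟨h1, h2⟩) (not_le.2 h3)⟩

/-- Both coordinates of a point of the graph lie in `P`, so the graph is a union of singletons
indexed by itself. -/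
theorem isSparseUnion_next (hL : ExpandsOrderedGroup L) (hP : Admissible P) (i j : α) :
    IsSparseUnion L P {v : α → ℝ | v i ∈ P ∧ next P (v i) = v j} := by
  refine ((expDefinable_next hL hP).isSparseUnion fun t ht k => ?_).preimage_comp ![i, j]
  fin_cases k
  · exact ht.1
  · exact ht.2 ▸ (hP.isLeast_next ht.1).1.1

/-- The half-open intervals `[z, s(z))` with `z ∈ P` isolate the value of `λ`. The right side is
positive in the graph of `s`, so sparseness passes to `λ`. -/
theorem lam_eq_iff (hP : Admissible P) {x z : ℝ} (hx : x ∈ conv P) :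
    lam P x = z ↔ ∃ y, (z ∈ P ∧ next P z = y) ∧ ¬ x < z ∧ x < y := by
  have hg := hP.isGreatest_lam hx
  constructor
  · rintro rfl
    refine ⟨_, ⟨hg.1.1, rfl⟩, not_lt.2 hg.1.2, ?_⟩
    have hn := (hP.isLeast_next hg.1.1).1
    by_contra! h
    exact absurd (hg.2 ⟨hn.1, h⟩) (not_le.2 hn.2)
  · rintro ⟨_, ⟨hz, rfl⟩, hzx, hxy⟩
    refine hg.unique ⟨⟨hz, not_lt.1 hzx⟩, fun w hw => ?_⟩
    by_contra! h
    exact absurd ((hP.isLeast_next hz).2 ⟨hw.1, h⟩) (not_le.2 (lt_of_le_of_lt hw.2 hxy))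

theorem isSparseUnion_lam (hL : ExpandsOrderedGroup L) (hP : Admissible P) (i j : α) :
    IsSparseUnion L P {v : α → ℝ | lam P (v i) = v j} := by
  have hc : RDefinable L {v : α → ℝ | v i ∈ conv P} :=
    hL.rDefinable_mem_ordConnected i (ordConnected_conv P)
  have hex := (((isSparseUnion_next hL hP (Sum.inl j) (Sum.inr (0 : Fin 1))).inter
    (RDefinable.isSparseUnion ((hL.rDefinable_lt (Sum.inl i) (Sum.inl j)).compl.inter
      (hL.rDefinable_lt (Sum.inl i) (Sum.inr 0))))).exists_of_finite)
  refine (congrArg _ ?_).mp ((hc.isSparseUnion.inter hex).union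
    (RDefinable.isSparseUnion (hc.compl.inter (rDefinable_eq_const j 0))))
  ext v
  by_cases hv : v i ∈ conv P
  · have h1 : (∃ y, (v j ∈ P ∧ next P (v j) = y) ∧ ¬ v i < v j ∧ v i < y) ↔
        ∃ w : Fin 1 → ℝ, (v j ∈ P ∧ next P (v j) = w 0) ∧ ¬ v i < v j ∧ v i < w 0 :=
      ⟨fun ⟨y, h⟩ => ⟨fun _ => y, h⟩, fun ⟨w, h⟩ => ⟨w 0, h⟩⟩
    rw [mem_ofPred_eq, lam_eq_iff hP hv, h1]
    exact ⟨fun h => h.elim And.right fun h => absurd hv h.1, fun h => Or.inl ⟨hv, h⟩⟩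
  · have h0 : lam P (v i) = 0 := if_neg hv
    rw [mem_ofPred_eq, h0]
    exact ⟨fun h => h.elim (fun h => absurd h.1 hv) fun h => h.2.symm,
      fun h => Or.inr ⟨hv, h.symm⟩⟩

/-! ### Graphs of iterates of basic functions -/

/-- The graph of a partial function of `k` variables. -/
def graph {k : ℕ} (F : (Fin k → ℝ) →. ℝ) : Set (Fin k ⊕ Fin 1 → ℝ) :=
  {w | w (Sum.inr 0) ∈ F (fun i => w (Sum.inl i))}

theorem mem_pred_iff (hP : Admissible P) {y z : ℝ} : z ∈ pred P y ↔ z ∈ P ∧ next P z = y := by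
  constructor
  · rintro ⟨h, rfl⟩
    exact h.choose_spec
  · rintro ⟨hz, h⟩
    have he : ∃ x ∈ P, next P x = y := ⟨z, hz, h⟩
    exact ⟨he, hP.injOn_next he.choose_spec.1 hz (he.choose_spec.2.trans h.symm)⟩

theorem mem_succ_iff {x z : ℝ} : z ∈ succ P x ↔ x ∈ P ∧ next P x = z :=
  ⟨fun ⟨h, e⟩ => ⟨h, e⟩, fun ⟨h, e⟩ => ⟨h, e⟩⟩

theorem IsBasic.isSparseUnion_graph (hL : ExpandsOrderedGroup L) (hP : Admissible P) {k : ℕ}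
    {F : (Fin k → ℝ) →. ℝ} (hF : IsBasic L P F) : IsSparseUnion L P (graph F) := by
  cases hF with
  | definable _ hF => exact RDefinable.isSparseUnion hF
  | lam =>
    refine (congrArg _ ?_).mp (isSparseUnion_lam hL hP (Sum.inl (0 : Fin 1)) (Sum.inr (0 : Fin 1)))
    ext w
    exact eq_comm.trans Part.mem_some_iff.symm
  | succ =>
    refine (congrArg _ ?_).mp (isSparseUnion_next hL hP (Sum.inl (0 : Fin 1)) (Sum.inr (0 : Fin 1)))
    ext w
    exact mem_succ_iff.symm
  | pred =>
    refine (congrArg _ ?_).mp (isSparseUnion_next hL hP (Sum.inr (0 : Fin 1)) (Sum.inl (0 : Fin 1)))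
    ext w
    exact (mem_pred_iff hP).symm

theorem mem_compTuple_iff {k l : ℕ} {F : (Fin k → ℝ) →. ℝ} {h : Fin k → ((Fin l → ℝ) →. ℝ)}
    {x : Fin l → ℝ} {z : ℝ} :
    z ∈ compTuple F h x ↔ ∃ y : Fin k → ℝ, (∀ i, y i ∈ h i x) ∧ z ∈ F y := by
  refine Part.mem_bind_iff.trans ?_
  refine exists_congr fun y => and_congr_left fun _ => ?_
  exact ⟨fun ⟨d, e⟩ i => ⟨d i, congrFun e i⟩, fun H => ⟨fun i => (H i).1, funext fun i => (H i).2⟩⟩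

theorem IsIterate.isSparseUnion_graph (hL : ExpandsOrderedGroup L) (hP : Admissible P) {l : ℕ}
    {F : (Fin l → ℝ) →. ℝ} (hF : IsIterate L P F) : IsSparseUnion L P (graph F) := by
  induction hF with
  | basic F hF => exact hF.isSparseUnion_graph hL hP
  | @comp k F hF h _ ih =>
    -- The values of the inner functions become `k` extra coordinates, which are then projected
    -- away.
    have h1 : IsSparseUnion L P _ := IsSparseUnion.iInter fun i => (ih i).preimage_comp
      (Sum.elim (Sum.inl ∘ Sum.inl) fun _ => Sum.inr i : Fin l ⊕ Fin 1 → (Fin l ⊕ Fin 1) ⊕ Fin k)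
    have h2 := (hF.isSparseUnion_graph hL hP).preimage_comp
      (Sum.elim Sum.inr (Sum.inl ∘ Sum.inr) : Fin k ⊕ Fin 1 → (Fin l ⊕ Fin 1) ⊕ Fin k)
    refine (congrArg _ ?_).mp (h1.inter h2).exists_of_finite
    ext w
    refine Iff.trans ?_ mem_compTuple_iff.symm
    refine exists_congr fun y => and_congr ?_ Iff.rfl
    rw [mem_iInter]
    exact Iff.rfl

theorem PropertyA.isSparseUnion (hL : ExpandsOrderedGroup L) (hP : Admissible P) {l : ℕ}
    {Y : Set (Fin l → ℝ)} (hY : PropertyA L P Y) : IsSparseUnion L P Y := by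
  obtain ⟨n, m, f, g, hf, hg, rfl⟩ := hY
  -- Each condition is a projection of a part of a graph, so it fails automatically where the
  -- function is undefined.
  have h1 : IsSparseUnion L P _ := IsSparseUnion.iInter fun i =>
    (((hf i).isSparseUnion_graph hL hP).inter
      (RDefinable.isSparseUnion (rDefinable_eq_const (Sum.inr 0) 0))).exists_of_finite
  have h2 : IsSparseUnion L P _ := IsSparseUnion.iInter fun j =>
    (((hg j).isSparseUnion_graph hL hP).inter
      (RDefinable.isSparseUnion (hL.rDefinable_const_lt (Sum.inr 0) 0))).exists_of_finite
  refine (congrArg _ ?_).mp (h1.inter h2)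
  ext x
  refine and_congr (mem_iInter.trans (forall_congr' fun i => ?_))
    (mem_iInter.trans (forall_congr' fun j => ?_))
  · refine ⟨fun ⟨w, h, e⟩ => ?_, fun h => ⟨fun _ => 0, h, rfl⟩⟩
    have e : w 0 = 0 := e
    have h : w 0 ∈ f i x := h
    rwa [e] at h
  · exact ⟨fun ⟨w, h, e⟩ => ⟨w 0, h, e⟩, fun ⟨z, h, e⟩ => ⟨fun _ => z, h, e⟩⟩

end SparseLemmas

/-! ### Dimension zero -/

/-- A nonempty set of tuples from a countable set has dimension `0`. -/
theorem coordDim_eq_zero {n : ℕ} {P : Set ℝ} (hP : P.Countable) {S : Set (Fin n → ℝ)}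
    (hS : S.Nonempty) (hSP : ∀ t ∈ S, ∀ j, t j ∈ P) : coordDim S = 0 := by
  apply le_antisymm
  · refine iSup₂_le fun I hI => ?_
    rcases I.eq_empty_or_nonempty with rfl | ⟨i, hi⟩
    · simp
    exfalso
    obtain ⟨y, hy⟩ := hI
    -- Projecting the interior further to one coordinate gives a nonempty open subset of `P`, but a
    -- countable set has dense complement.
    have hopen : IsOpen (Function.eval (⟨i, hi⟩ : I) ''
        interior ((fun (x : Fin n → ℝ) (i : I) => x i) '' S)) :=
      isOpenMap_eval _ _ isOpen_interior
    have hsub : Function.eval (⟨i, hi⟩ : I) ''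
        interior ((fun (x : Fin n → ℝ) (i : I) => x i) '' S) ⊆ P := by
      rintro _ ⟨z, hz, rfl⟩
      obtain ⟨t, ht, rfl⟩ := interior_subset hz
      exact hSP t ht i
    obtain ⟨w, hw, hw'⟩ := (hP.dense_compl ℝ).inter_open_nonempty _ hopen ⟨_, mem_image_of_mem _ hy⟩
    exact hw' (hsub hw)
  -- The projection to no coordinates is the whole one-point space because `S` is nonempty.
  · refine le_iSup₂_of_le (∅ : Finset (Fin n)) ?_ (by simp)
    obtain ⟨t, ht⟩ := hS
    have huniv : ((fun (x : Fin n → ℝ) (i : (∅ : Finset (Fin n))) => x i) '' S) = univ :=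
      eq_univ_of_forall fun y => ⟨t, ht, Subsingleton.elim _ _⟩
    rw [huniv, interior_univ]
    exact univ_nonempty

/-- A discrete subspace of the line is Lindelöf, hence countable. -/
theorem Admissible.countable {P : Set ℝ} (hP : Admissible P) : P.Countable := by
  have := hP.discrete.to_subtype
  exact countable_coe_iff.1 countable_of_Lindelof_of_discrete

end OMinExp

/-- Let `𝓡 = ⟨ℝ, <, +, …⟩` be o-minimal and let `P ⊆ ℝ` be discrete, closed in its convex hull,
without a maximum and positive. If every set definable in `⟨𝓡, P⟩` is a finite union of sets with
property (A), then `⟨𝓡, P⟩` has (DP)(I). -/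
theorem mainTheorem6 (L : FirstOrder.Language.{u, v}) [L.Structure ℝ]
    (hL : OMinExp.ExpandsOrderedGroup L) (hR : OMinExp.OMinimal L)
    (P : Set ℝ) (hP : OMinExp.Admissible P)
    (hA : ∀ (l : ℕ) (X : Set (Fin l → ℝ)), OMinExp.ExpDefinable L P X →
      ∃ T : Set (Set (Fin l → ℝ)), T.Finite ∧ X = ⋃₀ T ∧ ∀ Y ∈ T, OMinExp.PropertyA L P Y) :
    OMinExp.HasDPI L P := by
  intro n X hX
  obtain ⟨T, hT, rfl, hTA⟩ := hA n X hX
  obtain ⟨m, Z, S, hZ, hS, hSP, e⟩ :=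
    OMinExp.IsSparseUnion.sUnion hT fun Y hY => (hTA Y hY).isSparseUnion hL hP
  rw [e]
  rcases S.eq_empty_or_nonempty with rfl | hne
  -- An empty index set has dimension `⊥`, not `0`; the one-point space `ℝ⁰` with the empty family
  -- replaces it.
  · refine ⟨0, fun _ => ∅, univ, definable_empty, OMinExp.expDefinable_univ P,
      OMinExp.coordDim_eq_zero hP.countable univ_nonempty fun _ _ j => j.elim0, ?_⟩
    simp
  · refine ⟨m, fun t => {x | Sum.elim x t ∈ Z}, S, ?_, hS,
      OMinExp.coordDim_eq_zero hP.countable hne hSP, ?_⟩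
    · refine (congrArg _ ?_).mp hZ
      ext w
      rw [mem_ofPred_eq, mem_ofPred_eq]
      exact iff_of_eq (congrArg (· ∈ Z) (Sum.elim_comp_inl_inr w).symm)
    · ext x
      simp
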